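/- Let $n,m\ge 0$ and let $\mathcal P_2(\mathbb R^d)$ be the set of Borel probability measures on $\mathbb R^d$ with finite second moment. For $\pi\in\mathcal P_2(\mathbb R^n\times\mathbb R^m)$ let $(X,Y)\sim\pi$, let $\pi_Y$ be the law of $Y$, let $y\mapsto\pi_{X\mid Y=y}$ be a version of the conditional law (a Markov kernel), and let $\Sigma_{XY}=\mathrm{Cov}(X,Y)$, $\Sigma_{YY}=\mathrm{Cov}(Y)$. An affine conditioning map $L$ assigns to every $\pi\in\mathcal P_2(\mathbb R^n\times\mathbb R^m)$ and $y_\star\in\mathbb R^m$ an affine map $$L_{\pi,y_\star}(x,y)=A(\pi,y_\star)x+B(\pi,y_\star)y+c(\pi,y_\star),$$ with $A(\pi,y_\star)\in\mathbb R^{n\times n}$, $B(\pi,y_\star)\in\mathbb R^{n\times m}$, $c(\pi,y_\star)\in\mathbb R^n$. It is weakly $y_\star$-dependent if $A$ and $B$ depend on $\pi$ only. It is exact for $\pi$ if $(L_{\pi,y_\star})_\sharp\pi=\pi_{X\mid Y=y_\star}$ for $\pi_Y$-almost every $y_\star$ (this does not depend on the version of the conditional law). Let $\mathrm E(L)$ be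 the set of all $\pi\in\mathcal P_2(\mathbb R^n\times\mathbb R^m)$ for which $L$ is exact. The Ensemble Kalman Update is $$L^{\mathrm{EnKU}}_{\pi,y_\star}(x,y)=x+\Sigma_{XY}\Sigma_{YY}^{\dagger}(y_\star-y),$$ where $\dagger$ is the Moore–Penrose pseudoinverse. Put $$\mathrm E^{\mathrm{EnKU}}=\mathrm E(L^{\mathrm{EnKU}}),\qquad \mathrm F=\bigcup_{L\text{ weakly }y_\star\text{-dependent}}\mathrm E(L).$$ Let $\mathrm S_{\mathrm{nl\text{-}dec}}$ be the set of all $\pi\in\mathrm F$ for which there are $\nu\in\mathcal P_2(\mathbb R^n)$ and a measurable $d:\mathbb R^m\to\mathbb R^n$ such that some version of the conditional law satisfies $\pi_{X\mid Y=y}=(x\mapsto x+d(y))_\sharp\nu$ for all $y\in\mathbb R^m$, and there are $v\in\mathbb C^n\setminus\{0\}$, $w\in\mathbb C^m$, $u\in\mathbb C^n$, $\lambda\in\mathbb C$ with $|\lambda|<1$ and $b\in\mathbb C$ such that, for $Z\sim\nu$ and i.i.d. copies $Y^{(0)},Y^{(1)},\dots$ of $Y\sim\pi_Y$, $$v^\top(Z-\mathbb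 E Z)\stackrel{d}{=}\sum_{k=0}^\infty\lambda^k\bigl(w^\top Y^{(k)}+u^\top d(Y^{(k)})\bigr)+b,$$ the series converging almost surely. Then $$\mathrm F=\mathrm E^{\mathrm{EnKU}}\cup\mathrm S_{\mathrm{nl\text{-}dec}}.$$ -/

import Mathlib

open MeasureTheory ProbabilityTheory
open scoped Matrix

namespace AffineCond

/-- The four Penrose equations: `P` is a Moore–Penrose inverse of the real matrix `A`. -/
structure IsPenrose {k l : ℕ} (A : Matrix (Fin k) (Fin l) ℝ) (P : Matrix (Fin l) (Fin k) ℝ) :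
    Prop where
  mul_mul_self : A * P * A = A
  self_mul_mul : P * A * P = P
  symm_left : (A * P)ᵀ = A * P
  symm_right : (P * A)ᵀ = P * A

theorem IsPenrose.unique {k l : ℕ} {A : Matrix (Fin k) (Fin l) ℝ}
    {P Q : Matrix (Fin l) (Fin k) ℝ} (hP : IsPenrose A P) (hQ : IsPenrose A Q) : P = Q := by
  have hAP : A * P = A * Q := by
    calc A * P = (A * Q * A) * P := by rw [hQ.mul_mul_self]
      _ = (A * Q)ᵀ * (A * P)ᵀ := by rw [hQ.symm_left, hP.symm_left]; simp only [Matrix.mul_assoc]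
      _ = (A * P * A * Q)ᵀ := by
        rw [← Matrix.transpose_mul]; simp only [Matrix.mul_assoc]
      _ = A * Q := by rw [hP.mul_mul_self, hQ.symm_left]
  have hPA : P * A = Q * A := by
    calc P * A = P * (A * Q * A) := by rw [hQ.mul_mul_self]
      _ = (P * A)ᵀ * (Q * A)ᵀ := by rw [hQ.symm_right, hP.symm_right]; simp only [Matrix.mul_assoc]
      _ = (Q * (A * P * A))ᵀ := by
        rw [← Matrix.transpose_mul]; simp only [Matrix.mul_assoc]
      _ = Q * A := by rw [hP.mul_mul_self, hQ.symm_right]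
  calc P = P * A * P := hP.self_mul_mul.symm
    _ = Q * A * Q := by rw [Matrix.mul_assoc, hAP, ← Matrix.mul_assoc, hPA]
    _ = Q := hQ.self_mul_mul

theorem exists_isPenrose {k l : ℕ} (A : Matrix (Fin k) (Fin l) ℝ) :
    ∃ P : Matrix (Fin l) (Fin k) ℝ, IsPenrose A P := by
  -- `R` is the Moore–Penrose inverse of the symmetric matrix `Aᵀ * A`
  obtain ⟨R, h1, h2, h3, h4⟩ : ∃ R : Matrix (Fin l) (Fin l) ℝ,
      (Aᵀ * A) * R * (Aᵀ * A) = Aᵀ * A ∧ R * (Aᵀ * A) * R = R ∧ Rᵀ = R ∧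
        R * (Aᵀ * A) = (Aᵀ * A) * R := by
    have hS : (Aᵀ * A).IsHermitian := by
      simpa using Matrix.isHermitian_conjTranspose_mul_self A
    obtain ⟨U, μ, hU, hsp⟩ : ∃ (U : Matrix (Fin l) (Fin l) ℝ) (μ : Fin l → ℝ), Uᵀ * U = 1 ∧
        Aᵀ * A = U * Matrix.diagonal μ * Uᵀ := by
      refine ⟨hS.eigenvectorUnitary, hS.eigenvalues, ?_, ?_⟩
      · have := Unitary.coe_star_mul_self hS.eigenvectorUnitary
        simpa [Matrix.star_eq_conjTranspose] using this
      · have := hS.spectral_theorem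
        simpa [Unitary.conjStarAlgAut_apply, Matrix.star_eq_conjTranspose, Function.comp_def]
          using this
    have key : ∀ d e : Fin l → ℝ, (U * Matrix.diagonal d * Uᵀ) * (U * Matrix.diagonal e * Uᵀ)
        = U * Matrix.diagonal (fun i => d i * e i) * Uᵀ := by
      intro d e
      calc _ = U * Matrix.diagonal d * (Uᵀ * U) * Matrix.diagonal e * Uᵀ := by
            simp only [Matrix.mul_assoc]
        _ = _ := by
            rw [hU, Matrix.mul_one, Matrix.mul_assoc U, Matrix.diagonal_mul_diagonal]
    refine ⟨U * Matrix.diagonal (fun i => (μ i)⁻¹) * Uᵀ, ?_, ?_, ?_, ?_⟩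
    · rw [hsp, key, key]
      congr 3
      funext i
      by_cases h : μ i = 0 <;> simp [h]
    · rw [hsp, key, key]
      congr 3
      funext i
      by_cases h : μ i = 0 <;> simp [h]
    · simp [Matrix.transpose_mul, Matrix.mul_assoc]
    · rw [hsp, key, key]
      simp only [mul_comm]
  have h5 : A * (R * (Aᵀ * A)) = A := by
    have h : A * (R * (Aᵀ * A) - 1) = 0 := by
      rw [← Matrix.conjTranspose_mul_self_eq_zero]
      have h6 : (Aᵀ * A) * (R * (Aᵀ * A) - 1) = 0 := by
        rw [Matrix.mul_sub, ← Matrix.mul_assoc, h1, Matrix.mul_one, sub_self]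
      rw [Matrix.conjTranspose_mul, Matrix.mul_assoc, Matrix.conjTranspose_eq_transpose_of_trivial A,
        ← Matrix.mul_assoc Aᵀ, h6, Matrix.mul_zero]
    rwa [Matrix.mul_sub, Matrix.mul_one, sub_eq_zero] at h
  refine ⟨R * Aᵀ, ?_, ?_, ?_, ?_⟩
  · simpa only [Matrix.mul_assoc] using h5
  · calc R * Aᵀ * A * (R * Aᵀ) = (R * (Aᵀ * A) * R) * Aᵀ := by simp only [Matrix.mul_assoc]
      _ = R * Aᵀ := by rw [h2]
  · simp [Matrix.transpose_mul, h3, Matrix.mul_assoc]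
  · rw [Matrix.mul_assoc, Matrix.transpose_mul, h3, h4]
    simp [Matrix.transpose_mul]

/-- The Moore–Penrose pseudoinverse `A†` of a real matrix. -/
noncomputable def pinv {k l : ℕ} (A : Matrix (Fin k) (Fin l) ℝ) : Matrix (Fin l) (Fin k) ℝ :=
  (exists_isPenrose A).choose

theorem isPenrose_pinv {k l : ℕ} (A : Matrix (Fin k) (Fin l) ℝ) : IsPenrose A (pinv A) :=
  (exists_isPenrose A).choose_spec

/-- `ℝᵈ` with its Euclidean norm. -/
abbrev Vec (d : ℕ) : Type := EuclideanSpace ℝ (Fin d)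

/-- `𝒫₂(E)`: Borel probability measures on `E` with finite second moment. -/
abbrev P2 (E : Type) [NormedAddCommGroup E] [MeasurableSpace E] : Type :=
  {μ : Measure E // IsProbabilityMeasure μ ∧ MemLp id 2 μ}

instance {E : Type} [NormedAddCommGroup E] [MeasurableSpace E] (μ : P2 E) :
    IsProbabilityMeasure (μ : Measure E) := μ.2.1

/-- Joint laws on `ℝⁿ × ℝᵐ` of pairs `(X, Y)`, with finite second moment. -/
abbrev Joint (n m : ℕ) : Type := P2 (Vec n × Vec m)

/-- The marginal law `π_Y`. -/
noncomputable abbrev margY {n m : ℕ} (π : Joint n m) : Measure (Vec m) := π.1.snd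

/-- The cross-covariance matrix `Σ_XY`. -/
noncomputable def covXY {n m : ℕ} (π : Joint n m) : Matrix (Fin n) (Fin m) ℝ :=
  Matrix.of fun i j => covariance (fun p : Vec n × Vec m => p.1 i) (fun p => p.2 j) π.1

/-- The covariance matrix `Σ_YY`. -/
noncomputable def covYY {n m : ℕ} (π : Joint n m) : Matrix (Fin m) (Fin m) ℝ :=
  Matrix.of fun i j => covariance (fun p : Vec n × Vec m => p.2 i) (fun p => p.2 j) π.1

/-- The Kalman gain `K = Σ_XY Σ_YY†`. -/
noncomputable def kalmanGain {n m : ℕ} (π : Joint n m) : Matrix (Fin n) (Fin m) ℝ :=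
  covXY π * pinv (covYY π)

/-- The Markov kernel `κ` is a version of the conditional law `y ↦ π_{X ∣ Y = y}`. -/
def IsCondLaw {n m : ℕ} (π : Joint n m) (κ : Kernel (Vec m) (Vec n)) : Prop :=
  IsMarkovKernel κ ∧ (margY π).compProd κ = π.1.map Prod.swap

/-- The affine map `(x, y) ↦ A x + B y + c` from `ℝⁿ × ℝᵐ` to `ℝⁿ`. -/
noncomputable def affineMap {n m : ℕ} (A : Matrix (Fin n) (Fin n) ℝ)
    (B : Matrix (Fin n) (Fin m) ℝ) (c : Vec n) (p : Vec n × Vec m) : Vec n :=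
  Matrix.toEuclideanLin A p.1 + Matrix.toEuclideanLin B p.2 + c

/-- An affine conditioning map: it sends `(π, y⋆)` to the affine map
`(x, y) ↦ A(π, y⋆) x + B(π, y⋆) y + c(π, y⋆)`, given by its coefficients. -/
structure AffineCondMap (n m : ℕ) where
  /-- the coefficient of `x` -/
  A : Joint n m → Vec m → Matrix (Fin n) (Fin n) ℝ
  /-- the coefficient of `y` -/
  B : Joint n m → Vec m → Matrix (Fin n) (Fin m) ℝ
  /-- the offset -/
  c : Joint n m → Vec m → Vec n

/-- The affine map `L_{π, y⋆} : ℝⁿ × ℝᵐ → ℝⁿ`. -/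
noncomputable def AffineCondMap.toMap {n m : ℕ} (L : AffineCondMap n m) (π : Joint n m)
    (ystar : Vec m) : Vec n × Vec m → Vec n :=
  affineMap (L.A π ystar) (L.B π ystar) (L.c π ystar)

/-- Weak `y⋆`-dependence: `A` and `B` depend on `π` only. -/
def AffineCondMap.IsWeak {n m : ℕ} (L : AffineCondMap n m) : Prop :=
  ∃ (A : Joint n m → Matrix (Fin n) (Fin n) ℝ) (B : Joint n m → Matrix (Fin n) (Fin m) ℝ),
    ∀ π ystar, L.A π ystar = A π ∧ L.B π ystar = B π

/-- `L` is exact for `π`: `(L_{π, y⋆})_♯ π = π_{X ∣ Y = y⋆}` for `π_Y`-almost every `y⋆`.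
Versions of the conditional law agree `π_Y`-almost everywhere, so any version may be used. -/
def AffineCondMap.IsExact {n m : ℕ} (L : AffineCondMap n m) (π : Joint n m) : Prop :=
  ∃ κ : Kernel (Vec m) (Vec n), IsCondLaw π κ ∧
    ∀ᵐ ystar ∂(margY π), π.1.map (L.toMap π ystar) = κ ystar

/-- The exact set `E(L)`. -/
def exactSet {n m : ℕ} (L : AffineCondMap n m) : Set (Joint n m) :=
  {π | L.IsExact π}

/-- The Ensemble Kalman Update `(x, y) ↦ x + K(π) (y⋆ - y)`: `A = I`, `B = -K`, `c = K y⋆`. -/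
noncomputable def enKU (n m : ℕ) : AffineCondMap n m where
  A _ _ := 1
  B π _ := -kalmanGain π
  c π ystar := Matrix.toEuclideanLin (kalmanGain π) ystar

theorem enKU_toMap {n m : ℕ} (π : Joint n m) (ystar : Vec m) (x : Vec n) (y : Vec m) :
    (enKU n m).toMap π ystar (x, y) = x + Matrix.toEuclideanLin (kalmanGain π) (ystar - y) := by
  ext i
  simp [AffineCondMap.toMap, enKU, affineMap]
  ring

/-- `E^EnKU`, the set of laws for which the Ensemble Kalman Update is exact. -/
noncomputable def EEnKU (n m : ℕ) : Set (Joint n m) := exactSet (enKU n m)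

/-- `F`, the union of the exact sets of all weakly `y⋆`-dependent affine conditioning maps. -/
def F (n m : ℕ) : Set (Joint n m) :=
  ⋃ (L : AffineCondMap n m) (_ : L.IsWeak), exactSet L

/-- `(ν, d)` is a translation representation of `π`: `d` is measurable and some version of the
conditional law satisfies `π_{X ∣ Y = y} = (x ↦ x + d(y))_♯ ν` for all `y`. -/
def IsTranslationWitness {n m : ℕ} (π : Joint n m) (ν : P2 (Vec n)) (d : Vec m → Vec n) : Prop :=
  Measurable d ∧ ∃ κ : Kernel (Vec m) (Vec n), IsCondLaw π κ ∧
    ∀ y, κ y = ν.1.map (fun x => x + d y)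

/-- The bilinear (unconjugated) pairing `aᵀ x` of a complex with a real vector. -/
noncomputable def cdot {k : ℕ} (a : Fin k → ℂ) (x : Vec k) : ℂ := ∑ i, a i * (x i : ℂ)

/-- The class `S_nl-dec`: the laws `π ∈ F`, with translation representation `(ν, d)`, such that for
`Z ∼ ν` and i.i.d. copies `Y⁽⁰⁾, Y⁽¹⁾, …` of `Y ∼ π_Y` (realized as the coordinates on the infinite
product space) `vᵀ (Z - 𝔼 Z)` has the law of the almost surely convergent series
`∑ λᵏ (wᵀ Y⁽ᵏ⁾ + uᵀ d(Y⁽ᵏ⁾)) + b`. -/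
def SnlDec (n m : ℕ) : Set (Joint n m) :=
  {π | π ∈ F n m ∧ ∃ (ν : P2 (Vec n)) (d : Vec m → Vec n), IsTranslationWitness π ν d ∧
    ∃ (v : Fin n → ℂ) (w : Fin m → ℂ) (u : Fin n → ℂ) (lam b : ℂ), v ≠ 0 ∧ ‖lam‖ < 1 ∧
      (∀ᵐ Y ∂(Measure.infinitePi fun _ : ℕ => margY π),
        Summable fun k : ℕ => lam ^ k * (cdot w (Y k) + cdot u (d (Y k)))) ∧
      IdentDistrib (fun z : Vec n => cdot v (z - ∫ x, x ∂ν.1))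
        (fun Y : ℕ → Vec m => ∑' k : ℕ, lam ^ k * (cdot w (Y k) + cdot u (d (Y k))) + b)
        ν.1 (Measure.infinitePi fun _ : ℕ => margY π)}

end AffineCond

/-!
Let `π ∈ F`, with `A`, `B` the coefficients of a weakly `y⋆`-dependent map that is exact for `π`.
Exactness says that every conditional law is a translate of `ν = law(A X + B Y)`, so that
`X = Z + d(Y)` with `Z ∼ ν` independent of `Y` (`exists_isTranslationWitness`,
`IsTranslationWitness.map_prod_eq`). Inserting this into the definition of `ν` gives the
fixed-point equation `Z =ᵈ A Z + g(Y)` with `g(y) = A d(y) + B y`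
(`IsTranslationWitness.map_affine_eq`), and three cases arise.

* `A` has a left eigenvector `v` with eigenvalue `λ`, `|λ| < 1`. Pairing with `v` turns the
  equation into `vᵀZ =ᵈ λ vᵀZ + vᵀg(Y)`; iterating it on the characteristic function identifies the
  law of `vᵀZ` as that of `∑ λᵏ vᵀg(Y⁽ᵏ⁾)` (`map_perpetuity_eq`, `mem_SnlDec_of_eigenvector`).
* Some `vᵀZ`, `v ≠ 0`, is almost surely constant. Then `π ∈ S_nl-dec` with `λ = 0` and a zero series
  (`mem_SnlDec_of_variance_eq_zero`).
* Otherwise `Σ = Cov(Z)` is positive definite, all eigenvalues of `A` have modulus at least `1`, and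
  `Σ = A Σ Aᵀ + Cov(g(Y))`. Since `|det A| ≥ 1`, the determinant of `A Σ Aᵀ ≤ Σ` is at least that of
  `Σ`, which forces `A Σ Aᵀ = Σ` (`eq_conj_of_one_le_norm_eigenvalues`). Hence `g(Y)` is constant,
  `A` is invertible and `d` is affine (`ae_affine_or_mem_SnlDec`). For affine `d` the Kalman gain
  reproduces the slope of `d` on the support of the centred `Y`, so the Ensemble Kalman Update is
  exact (`mem_EEnKU_of_ae_affine`).

The reverse inclusion holds because the Ensemble Kalman Update is itself weakly `y⋆`-dependent and
`S_nl-dec` is a subset of `F` by definition.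
-/

namespace AffineCond

open Filter Topology ComplexConjugate
open scoped MatrixOrder

variable {n m : ℕ}

/-! ### Determinants and the Loewner order -/

/-- The eigenvalues `λᵢ` of `N` satisfy `∑ (λᵢ - 1) ≥ ∑ log λᵢ = log det N ≥ 0`, so the positive
semidefinite matrix `1 - N` has nonpositive trace and vanishes. -/
theorem eq_one_of_one_le_det {k : ℕ} {N : Matrix (Fin k) (Fin k) ℝ} (hN : N.PosSemidef)
    (hle : (1 - N).PosSemidef) (hdet : 1 ≤ N.det) : N = 1 := by
  have hprod : N.det = ∏ i, hN.1.eigenvalues i := by simpa using hN.1.det_eq_prod_eigenvalues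
  have htr : N.trace = ∑ i, hN.1.eigenvalues i := by simpa using hN.1.trace_eq_sum_eigenvalues
  have hne : ∀ i ∈ Finset.univ, hN.1.eigenvalues i ≠ 0 := by
    apply Finset.prod_ne_zero_iff.mp
    rw [← hprod]; positivity
  have hpos : ∀ i, 0 < hN.1.eigenvalues i := fun i =>
    lt_of_le_of_ne (hN.eigenvalues_nonneg i) (hne i (Finset.mem_univ i)).symm
  have hlog : 0 ≤ ∑ i, Real.log (hN.1.eigenvalues i) := by
    rw [← Real.log_prod hne, ← hprod]
    exact Real.log_nonneg hdet
  have hsum : ∑ i, Real.log (hN.1.eigenvalues i) ≤ ∑ i, (hN.1.eigenvalues i - 1) :=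
    Finset.sum_le_sum fun i _ => Real.log_le_sub_one_of_pos (hpos i)
  have hle0 : (1 - N).trace ≤ 0 := by
    rw [Matrix.trace_sub, htr, Matrix.trace_one]
    simp only [Finset.sum_sub_distrib, Finset.sum_const, Finset.card_univ, nsmul_eq_mul,
      mul_one] at hsum
    linarith
  have := hle.trace_eq_zero_iff.mp (le_antisymm hle0 hle.trace_nonneg)
  exact (sub_eq_zero.mp this).symm

/-- A positive semidefinite `Q ≤ P` whose determinant is at least that of the positive definite `P`
equals `P`: with `P = Sᴴ S`, this is `eq_one_of_one_le_det` for `S⁻ᴴ Q S⁻¹`. -/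
theorem eq_of_det_le {k : ℕ} {P Q : Matrix (Fin k) (Fin k) ℝ} (hP : P.PosDef)
    (hQ : Q.PosSemidef) (hle : (P - Q).PosSemidef) (hdet : P.det ≤ Q.det) : Q = P := by
  obtain ⟨S, hS⟩ : ∃ S : Matrix (Fin k) (Fin k) ℝ, P = Sᴴ * S :=
    CStarAlgebra.nonneg_iff_eq_star_mul_self.mp hP.posSemidef.nonneg
  have hPdet : 0 < P.det := hP.det_pos
  have hSdet : S.det ≠ 0 := by
    intro h
    rw [hS, Matrix.det_mul, h, mul_zero] at hPdet
    exact lt_irrefl _ hPdet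
  have hSu : IsUnit S.det := hSdet.isUnit
  have hSu' : IsUnit Sᴴ.det := by simpa using hSu
  have hPn : (S⁻¹)ᴴ * P * S⁻¹ = 1 := by
    rw [hS, Matrix.conjTranspose_nonsing_inv, Matrix.mul_assoc, Matrix.mul_assoc,
      Matrix.mul_nonsing_inv _ hSu, Matrix.mul_one, Matrix.nonsing_inv_mul _ hSu']
  have hN : (S⁻¹)ᴴ * Q * S⁻¹ = 1 := by
    apply eq_one_of_one_le_det
    · exact hQ.conjTranspose_mul_mul_same S⁻¹
    · rw [← hPn, ← Matrix.sub_mul, ← Matrix.mul_sub]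
      exact hle.conjTranspose_mul_mul_same S⁻¹
    · have h1 := congrArg Matrix.det hPn
      simp only [Matrix.det_mul, Matrix.det_one] at h1 ⊢
      have h2 : 0 < (S⁻¹)ᴴ.det * S⁻¹.det := by nlinarith
      nlinarith
  have := hN.trans hPn.symm
  have h3 := congrArg (fun M => Sᴴ * M * S) this
  simpa only [Matrix.conjTranspose_nonsing_inv, Matrix.mul_assoc, Matrix.nonsing_inv_mul _ hSu,
    Matrix.mul_one, Matrix.mul_nonsing_inv_cancel_left _ _ hSu'] using h3

theorem one_le_abs_det {k : ℕ} (A : Matrix (Fin k) (Fin k) ℝ)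
    (hA : ∀ (μ : ℂ) (v : Fin k → ℂ), v ≠ 0 → v ᵥ* A.map ((↑) : ℝ → ℂ) = μ • v → 1 ≤ ‖μ‖) :
    1 ≤ |A.det| := by
  set Ac : Matrix (Fin k) (Fin k) ℂ := A.map ((↑) : ℝ → ℂ) with hAc
  have hdet : Ac.det = (A.det : ℂ) := (Complex.ofRealHom.map_det A).symm
  have hnorm : |A.det| = (Ac.charpoly.roots.map (fun z : ℂ => ‖z‖)).prod := by
    rw [← Real.norm_eq_abs, ← Complex.norm_real, ← hdet, Matrix.det_eq_prod_roots_charpoly]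
    exact map_multiset_prod (normHom : ℂ →*₀ ℝ) _
  rw [hnorm]
  refine Multiset.prod_induction (fun x : ℝ => 1 ≤ x) _
    (fun a b ha hb => one_le_mul_of_one_le_of_one_le ha hb) le_rfl fun x hx => ?_
  obtain ⟨μ, hμ, rfl⟩ := Multiset.mem_map.mp hx
  have hroot := (Polynomial.mem_roots'.mp hμ).2
  rw [Polynomial.IsRoot, Matrix.eval_charpoly] at hroot
  obtain ⟨v, hv, hv0⟩ := Matrix.exists_vecMul_eq_zero_iff.mpr hroot
  refine hA μ v hv ?_
  rw [Matrix.vecMul_sub, sub_eq_zero] at hv0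
  rw [← hv0, Matrix.scalar_apply]
  ext i
  simp [mul_comm]

theorem eq_conj_of_one_le_norm_eigenvalues {k : ℕ} {A P : Matrix (Fin k) (Fin k) ℝ}
    (hA : ∀ (μ : ℂ) (v : Fin k → ℂ), v ≠ 0 → v ᵥ* A.map ((↑) : ℝ → ℂ) = μ • v → 1 ≤ ‖μ‖)
    (hP : P.PosDef) (hle : (P - A * P * Aᵀ).PosSemidef) : A * P * Aᵀ = P := by
  have h1 := one_le_abs_det A hA
  apply eq_of_det_le hP ?_ hle
  · rw [Matrix.det_mul, Matrix.det_mul, Matrix.det_transpose]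
    have h2 : 1 ≤ A.det ^ 2 := by rw [← sq_abs]; nlinarith
    nlinarith [hP.det_pos]
  · simpa using hP.posSemidef.mul_mul_conjTranspose_same A

/-! ### Scalar perpetuities -/

section Perpetuity

variable {E : Type*} [MeasurableSpace E] {σ : Measure E} [IsProbabilityMeasure σ] {η : E → ℂ}
  {l : ℂ}

/-- The expectation of `∑ ‖l ^ k * η (Y k)‖` is at most `𝔼‖η‖ / (1 - ‖l‖)`. -/
theorem ae_summable_perpetuity (hη : Measurable η) (hint : Integrable η σ) (hl : ‖l‖ < 1) :
    ∀ᵐ Y ∂(Measure.infinitePi fun _ : ℕ => σ), Summable fun k : ℕ => l ^ k * η (Y k) := by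
  have hmp : ∀ k : ℕ, MeasurePreserving (Function.eval k)
      (Measure.infinitePi fun _ : ℕ => σ) σ := fun k => measurePreserving_eval_infinitePi _ k
  have hm : ∀ k : ℕ, Measurable fun Y : ℕ → E => ‖l ^ k * η (Y k)‖ₑ := fun k =>
    ((hη.comp (measurable_pi_apply k)).const_mul _).enorm
  have hfin : ∫⁻ Y, ∑' k : ℕ, ‖l ^ k * η (Y k)‖ₑ ∂(Measure.infinitePi fun _ : ℕ => σ) ≠ ⊤ := by
    rw [lintegral_tsum fun k => (hm k).aemeasurable]
    have : ∀ k : ℕ, ∫⁻ Y, ‖l ^ k * η (Y k)‖ₑ ∂(Measure.infinitePi fun _ : ℕ => σ)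
        = ‖l‖ₑ ^ k * ∫⁻ y, ‖η y‖ₑ ∂σ := by
      intro k
      simp only [enorm_mul, enorm_pow]
      rw [lintegral_const_mul _ (by fun_prop), ← (hmp k).lintegral_comp hη.enorm]
    simp only [this]
    rw [ENNReal.tsum_mul_right, ENNReal.tsum_geometric]
    refine ENNReal.mul_ne_top ?_ hint.2.ne
    rw [ENNReal.inv_ne_top, Ne, tsub_eq_zero_iff_le, not_le]
    rw [← ofReal_norm]
    exact ENNReal.ofReal_lt_one.mpr hl
  filter_upwards [ae_lt_top (Measurable.tsum hm) hfin] with Y hY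
  refine Summable.of_enorm ?_
  exact hY.ne

theorem charFun_map_const_mul (ρ : Measure ℂ) (t : ℂ) :
    charFun (ρ.map (fun z => l * z)) t = charFun ρ (conj l * t) := by
  rw [charFun_apply, integral_map (by fun_prop) (by fun_prop), charFun_apply]
  congr 1 with z
  simp [Complex.inner, mul_assoc, mul_left_comm]

/-- If `R =ᵈ l R + η(Y)` with `R ∼ ρ` independent of `Y ∼ σ` and `‖l‖ < 1`, then `R` has the law of
the series `∑ lᵏ η(Y⁽ᵏ⁾)`. Iterating the equation writes the characteristic function of `ρ` at `t` as
that of the `N`-th partial sum at `t` times the value of the former at `conj l ^ N * t`, which tends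
to `1`. -/
theorem map_perpetuity_eq {ρ : Measure ℂ} [IsProbabilityMeasure ρ] (hη : Measurable η)
    (hint : Integrable η σ) (hl : ‖l‖ < 1)
    (hρ : (ρ.prod σ).map (fun p => l * p.1 + η p.2) = ρ) :
    (Measure.infinitePi fun _ : ℕ => σ).map (fun Y => ∑' k : ℕ, l ^ k * η (Y k)) = ρ := by
  set Q := Measure.infinitePi fun _ : ℕ => σ with hQ
  set φ := charFun (σ.map η) with hφ
  have hmp : ∀ k : ℕ, MeasurePreserving (Function.eval k) Q σ :=
    fun k => measurePreserving_eval_infinitePi _ k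
  -- one application of the fixed-point equation
  have hstep : ∀ t, charFun ρ t = charFun ρ (conj l * t) * φ t := by
    intro t
    have h1 : ρ = (ρ.map (fun z => l * z)) ∗ (σ.map η) := by
      rw [Measure.conv, Measure.map_prod_map _ _ (by fun_prop) hη,
        Measure.map_map (by fun_prop) (by fun_prop)]
      exact hρ.symm
    have : IsProbabilityMeasure (ρ.map (fun z => l * z)) :=
      Measure.isProbabilityMeasure_map (by fun_prop)
    have : IsProbabilityMeasure (σ.map η) := Measure.isProbabilityMeasure_map (by fun_prop)
    conv_lhs => rw [h1]
    rw [charFun_conv, charFun_map_const_mul]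
  have hiter : ∀ N t, charFun ρ t
      = charFun ρ (conj l ^ N * t) * ∏ k ∈ Finset.range N, φ (conj l ^ k * t) := by
    intro N t
    induction N with
    | zero => simp
    | succ N ih =>
      rw [ih, hstep, Finset.prod_range_succ, pow_succ', mul_assoc (conj l)]
      ring
  set S : ℕ → (ℕ → E) → ℂ := fun N Y => ∑ k ∈ Finset.range N, l ^ k * η (Y k) with hS
  have hSm : ∀ N, Measurable (S N) := fun N => by fun_prop
  have hSchar : ∀ N t, charFun (Q.map (S N)) t = ∏ k ∈ Finset.range N, φ (conj l ^ k * t) := by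
    intro N t
    have hind : iIndepFun (fun (k : ℕ) (Y : ℕ → E) => l ^ k * η (Y k)) Q :=
      iIndepFun_infinitePi (P := fun _ : ℕ => σ) (X := fun k y => l ^ k * η y)
        (fun k => by fun_prop)
    have hZm : ∀ k : ℕ, Measurable fun Y : ℕ → E => l ^ k * η (Y k) := fun k => by fun_prop
    rw [hS]
    dsimp only
    rw [(hind.restrict _).charFun_map_fun_finsetSum_eq_prod (fun k _ => (hZm k).aemeasurable)]
    rw [Finset.prod_apply]
    refine Finset.prod_congr rfl fun k _ => ?_
    rw [hφ, ← map_pow, ← charFun_map_const_mul, Measure.map_map (by fun_prop) hη,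
      ← (hmp k).map_eq, Measure.map_map (by fun_prop) (hmp k).measurable]
    rfl
  have hsum := ae_summable_perpetuity hη hint hl
  rw [← hQ] at hsum
  have hlimS : ∀ᵐ Y ∂Q, Tendsto (fun N => S N Y) atTop (𝓝 (∑' k : ℕ, l ^ k * η (Y k))) := by
    filter_upwards [hsum] with Y hY
    exact hY.hasSum.tendsto_sum_nat
  have hTm : AEMeasurable (fun Y : ℕ → E => ∑' k : ℕ, l ^ k * η (Y k)) Q :=
    aemeasurable_of_tendsto_metrizable_ae atTop (fun N => (hSm N).aemeasurable) hlimS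
  have : IsProbabilityMeasure (Q.map fun Y : ℕ → E => ∑' k : ℕ, l ^ k * η (Y k)) :=
    Measure.isProbabilityMeasure_map hTm
  apply Measure.ext_of_charFun
  ext t
  have hlim1 : Tendsto (fun N => charFun (Q.map (S N)) t) atTop
      (𝓝 (charFun (Q.map fun Y : ℕ → E => ∑' k : ℕ, l ^ k * η (Y k)) t)) := by
    simp only [charFun_apply]
    rw [integral_map hTm (by fun_prop)]
    simp_rw [fun N => integral_map (μ := Q) (hSm N).aemeasurable
      (f := fun x : ℂ => Complex.exp ((inner ℝ x t : ℝ) * Complex.I)) (by fun_prop)]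
    refine tendsto_integral_of_dominated_convergence (fun _ => 1)
      (fun N => by fun_prop) (integrable_const _) (fun N => ?_) ?_
    · filter_upwards with Y
      rw [Complex.norm_exp_ofReal_mul_I]
    · filter_upwards [hlimS] with Y hY
      have hc : Continuous fun x : ℂ => Complex.exp ((inner ℝ x t : ℝ) * Complex.I) := by fun_prop
      exact (hc.tendsto _).comp hY
  have hlim2 : Tendsto (fun N => charFun ρ (conj l ^ N * t)) atTop (𝓝 1) := by
    have h0 : Tendsto (fun N : ℕ => conj l ^ N * t) atTop (𝓝 0) := by
      have : Tendsto (fun N : ℕ => conj l ^ N) atTop (𝓝 0) :=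
        tendsto_pow_atTop_nhds_zero_of_norm_lt_one (by simpa using hl)
      simpa using this.mul_const t
    have hc : Tendsto (charFun ρ) (𝓝 0) (𝓝 (charFun ρ 0)) := continuous_charFun.tendsto 0
    rw [charFun_zero, probReal_univ] at hc
    exact_mod_cast hc.comp h0
  have hlim3 := hlim2.mul hlim1
  rw [one_mul] at hlim3
  refine tendsto_nhds_unique hlim3 ?_
  simp only [hSchar, ← hiter]
  exact tendsto_const_nhds

end Perpetuity

/-! ### Translation representations -/

@[simp]
theorem ofLp_toEuclideanLin {k l : ℕ} (A : Matrix (Fin k) (Fin l) ℝ) (x : Vec l) :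
    (Matrix.toEuclideanLin A x).ofLp = A *ᵥ x.ofLp := by
  rfl

theorem continuous_toEuclideanLin {k l : ℕ} (A : Matrix (Fin k) (Fin l) ℝ) :
    Continuous (Matrix.toEuclideanLin A) :=
  LinearMap.continuous_of_finiteDimensional _

@[fun_prop]
theorem measurable_toEuclideanLin {k l : ℕ} (A : Matrix (Fin k) (Fin l) ℝ) :
    Measurable (Matrix.toEuclideanLin A) :=
  (continuous_toEuclideanLin A).measurable

@[fun_prop]
theorem measurable_affineMap (A : Matrix (Fin n) (Fin n) ℝ) (B : Matrix (Fin n) (Fin m) ℝ)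
    (c : Vec n) : Measurable (affineMap A B c) := by
  unfold affineMap
  fun_prop

theorem memLp_toEuclideanLin_comp {k l : ℕ} {Ω : Type*} [MeasurableSpace Ω] {μ : Measure Ω}
    {f : Ω → Vec l} (A : Matrix (Fin k) (Fin l) ℝ) (hf : MemLp f 2 μ) :
    MemLp (fun ω => Matrix.toEuclideanLin A (f ω)) 2 μ :=
  (Matrix.toEuclideanLin A).toContinuousLinearMap.comp_memLp' hf

/-- The law of `A X + B Y` for `(X, Y) ∼ π`. -/
noncomputable def linearPush (π : Joint n m) (A : Matrix (Fin n) (Fin n) ℝ)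
    (B : Matrix (Fin n) (Fin m) ℝ) : P2 (Vec n) :=
  ⟨π.1.map (affineMap A B 0), Measure.isProbabilityMeasure_map (by fun_prop), by
    rw [memLp_map_measure_iff (by fun_prop) (by fun_prop)]
    have h1 : MemLp (fun p : Vec n × Vec m => p.1) 2 π.1 := π.2.2.fst
    have h2 : MemLp (fun p : Vec n × Vec m => p.2) 2 π.1 := π.2.2.snd
    refine ((memLp_toEuclideanLin_comp A h1).add (memLp_toEuclideanLin_comp B h2)).ae_eq
      (Filter.Eventually.of_forall fun p => ?_)
    simp [affineMap]⟩

/-- The Markov kernel `y ↦ (x ↦ x + d(y))_♯ ν`. -/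
noncomputable def translationKernel (ν : Measure (Vec n)) [IsProbabilityMeasure ν]
    {d : Vec m → Vec n} (hd : Measurable d) : Kernel (Vec m) (Vec n) :=
  ((Kernel.const _ ν) ×ₖ (Kernel.deterministic d hd)).map (fun p => p.1 + p.2)

theorem translationKernel_apply (ν : Measure (Vec n)) [IsProbabilityMeasure ν]
    {d : Vec m → Vec n} (hd : Measurable d) (y : Vec m) :
    translationKernel ν hd y = ν.map (fun x => x + d y) := by
  rw [translationKernel, Kernel.map_apply _ (by fun_prop), Kernel.prod_apply, Kernel.const_apply,
    Kernel.deterministic_apply, Measure.prod_dirac, Measure.map_map (by fun_prop) (by fun_prop)]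
  rfl

instance (ν : Measure (Vec n)) [IsProbabilityMeasure ν] {d : Vec m → Vec n} (hd : Measurable d) :
    IsMarkovKernel (translationKernel ν hd) := by
  unfold translationKernel
  exact Kernel.IsMarkovKernel.map _ (by fun_prop)

/-- Exactness of a weakly `y⋆`-dependent map makes every conditional law a translate of the law of
`A X + B Y`. -/
theorem exists_isTranslationWitness {π : Joint n m} (hπ : π ∈ F n m) :
    ∃ A B d, IsTranslationWitness π (linearPush π A B) d := by
  simp only [F, Set.mem_iUnion] at hπ
  obtain ⟨L, ⟨A', B', hL⟩, κ, ⟨hκm, hκ⟩, hex⟩ := hπ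
  set A := A' π
  set B := B' π
  set ν := linearPush π A B with hν
  have hνi : Integrable (fun x : Vec n => x) ν.1 := ν.2.2.integrable (by norm_num)
  have hmap : ∀ y, π.1.map (L.toMap π y) = ν.1.map (fun x => x + L.c π y) := by
    intro y
    rw [hν, linearPush, Measure.map_map (by fun_prop) (by fun_prop)]
    congr 1
    ext1 p
    simp [AffineCondMap.toMap, affineMap, hL π y, A, B]
  -- the translation is recovered from the conditional mean, which is measurable in `y`
  have hd : Measurable fun y : Vec m => ∫ x, x ∂(κ y) - ∫ x, x ∂ν.1 :=
    (StronglyMeasurable.integral_kernel stronglyMeasurable_id).measurable.sub measurable_const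
  refine ⟨A, B, _, hd, translationKernel ν.1 hd, ⟨inferInstance, ?_⟩,
    translationKernel_apply ν.1 hd⟩
  rw [← hκ]
  apply Measure.compProd_congr
  filter_upwards [hex] with y hy
  rw [translationKernel_apply, ← hy, hmap, integral_map (by fun_prop) (by fun_prop),
    integral_add hνi (integrable_const _)]
  simp

section Witness

variable {π : Joint n m} {ν : P2 (Vec n)} {d : Vec m → Vec n}

/-- Under a translation representation, `π` is the law of `(Z + d(Y), Y)` with `Z ∼ ν` and
`Y ∼ π_Y` independent. -/
theorem IsTranslationWitness.map_prod_eq (h : IsTranslationWitness π ν d) :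
    (ν.1.prod (margY π)).map (fun p => (p.1 + d p.2, p.2)) = π.1 := by
  obtain ⟨hd, κ, ⟨hκm, hκ⟩, hκd⟩ := h
  ext s hs
  have hpre : π.1 s = (π.1.map Prod.swap) (Prod.swap ⁻¹' s) := by
    rw [Measure.map_apply measurable_swap (measurable_swap hs), ← Set.preimage_comp]
    simp
  rw [hpre, ← hκ, Measure.compProd_apply (measurable_swap hs),
    Measure.map_apply (by fun_prop) hs, Measure.prod_apply_symm (by measurability)]
  refine lintegral_congr fun y => ?_
  rw [hκd, Measure.map_apply (by fun_prop) (measurable_prodMk_left (measurable_swap hs))]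
  rfl

theorem IsTranslationWitness.measurePreserving (h : IsTranslationWitness π ν d) :
    MeasurePreserving (fun p => (p.1 + d p.2, p.2)) (ν.1.prod (margY π)) π.1 := by
  have := h.1
  exact ⟨by fun_prop, h.map_prod_eq⟩

theorem IsTranslationWitness.memLp (h : IsTranslationWitness π ν d) :
    MemLp d 2 (margY π) := by
  have hd := h.1
  have h1 : MemLp (fun p : Vec n × Vec m => p.1 + d p.2) 2 (ν.1.prod (margY π)) :=
    (π.2.2.fst : MemLp (fun p : Vec n × Vec m => p.1) 2 π.1).comp_measurePreserving
      h.measurePreserving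
  have h2 : MemLp (fun p : Vec n × Vec m => p.1) 2 (ν.1.prod (margY π)) :=
    ν.2.2.comp_measurePreserving measurePreserving_fst
  have h3 : MemLp (fun p : Vec n × Vec m => d p.2) 2 (ν.1.prod (margY π)) := by
    refine (h1.sub h2).ae_eq (Filter.Eventually.of_forall fun p => ?_)
    simp
  have h4 : Measure.map (fun p : Vec n × Vec m => p.2) (ν.1.prod (margY π)) = margY π :=
    measurePreserving_snd.map_eq
  rw [← h4, memLp_map_measure_iff (by fun_prop) (by fun_prop)]
  exact h3

theorem memLp_id_margY (π : Joint n m) : MemLp (fun y => y) 2 (margY π) := by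
  rw [margY, Measure.snd, memLp_map_measure_iff (by fun_prop) (by fun_prop)]
  exact π.2.2.snd

end Witness

/-- The fixed-point equation of the translation noise: `Z` has the law of
`A Z + (A d(Y) + B Y)`. -/
theorem IsTranslationWitness.map_affine_eq {π : Joint n m} {A : Matrix (Fin n) (Fin n) ℝ}
    {B : Matrix (Fin n) (Fin m) ℝ} {d : Vec m → Vec n}
    (h : IsTranslationWitness π (linearPush π A B) d) :
    ((linearPush π A B).1.prod (margY π)).map (fun p => Matrix.toEuclideanLin A p.1 +
      (Matrix.toEuclideanLin A (d p.2) + Matrix.toEuclideanLin B p.2))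
      = (linearPush π A B).1 := by
  have hd := h.1
  conv_rhs => rw [show (linearPush π A B).1 = π.1.map (affineMap A B 0) from rfl, ← h.map_prod_eq]
  rw [Measure.map_map (by fun_prop) (by fun_prop)]
  congr 1
  ext1 p
  simp [affineMap, add_assoc]

/-! ### Membership in `S_nl-dec` -/

theorem cdot_eq_dotProduct {k : ℕ} (a : Fin k → ℂ) (x : Vec k) :
    cdot a x = a ⬝ᵥ fun i => (x i : ℂ) := rfl

theorem cdot_add {k : ℕ} (a : Fin k → ℂ) (x y : Vec k) : cdot a (x + y) = cdot a x + cdot a y := by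
  simp [cdot, mul_add, Finset.sum_add_distrib]

theorem cdot_sub {k : ℕ} (a : Fin k → ℂ) (x y : Vec k) : cdot a (x - y) = cdot a x - cdot a y := by
  simp [cdot, mul_sub, Finset.sum_sub_distrib]

theorem smul_cdot {k : ℕ} (r : ℂ) (a : Fin k → ℂ) (x : Vec k) :
    cdot (r • a) x = r * cdot a x := by
  simp [cdot, mul_assoc, Finset.mul_sum]

theorem cdot_toEuclideanLin {k l : ℕ} (a : Fin k → ℂ) (A : Matrix (Fin k) (Fin l) ℝ) (x : Vec l) :
    cdot a (Matrix.toEuclideanLin A x) = cdot (a ᵥ* A.map ((↑) : ℝ → ℂ)) x := by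
  rw [cdot_eq_dotProduct, cdot_eq_dotProduct, ← Matrix.dotProduct_mulVec]
  congr 1
  ext i
  simp [Matrix.mulVec, dotProduct]

@[fun_prop]
theorem measurable_cdot {k : ℕ} (a : Fin k → ℂ) : Measurable (cdot a) := by
  unfold cdot
  fun_prop

theorem integrable_cdot_comp {k : ℕ} {Ω : Type*} [MeasurableSpace Ω] {μ : Measure Ω}
    {f : Ω → Vec k} (a : Fin k → ℂ) (hf : Integrable f μ) :
    Integrable (fun ω => cdot a (f ω)) μ := by
  unfold cdot
  refine integrable_finsetSum _ fun i _ => Integrable.const_mul (Integrable.ofReal ?_) _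
  exact (EuclideanSpace.proj (𝕜 := ℝ) i).integrable_comp hf

/-- Pairing the fixed-point equation with a left eigenvector of `A` gives the scalar equation
`vᵀZ =ᵈ l vᵀZ + wᵀY + uᵀd(Y)` with `w = Bᵀ v` and `u = l v`. -/
theorem mem_SnlDec_of_eigenvector {π : Joint n m} (hπ : π ∈ F n m)
    {A : Matrix (Fin n) (Fin n) ℝ} {B : Matrix (Fin n) (Fin m) ℝ} {d : Vec m → Vec n}
    (h : IsTranslationWitness π (linearPush π A B) d) {l : ℂ} {v : Fin n → ℂ} (hv : v ≠ 0)
    (hvl : v ᵥ* A.map ((↑) : ℝ → ℂ) = l • v) (hl : ‖l‖ < 1) : π ∈ SnlDec n m := by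
  have hd := h.1
  set ν := linearPush π A B with hν
  set w := v ᵥ* B.map ((↑) : ℝ → ℂ) with hw
  set η : Vec m → ℂ := fun y => cdot w y + cdot (l • v) (d y) with hη
  have hηm : Measurable η := by fun_prop
  have hηi : Integrable η (margY π) :=
    (integrable_cdot_comp w ((memLp_id_margY π).integrable (by norm_num))).add
      (integrable_cdot_comp _ (h.memLp.integrable (by norm_num)))
  have hfix : ((ν.1.map (cdot v)).prod (margY π)).map (fun p => l * p.1 + η p.2)
      = ν.1.map (cdot v) := by
    conv_rhs => rw [← h.map_affine_eq]
    rw [← Measure.map_id (μ := margY π), Measure.map_prod_map _ _ (by fun_prop) measurable_id,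
      Measure.map_id, Measure.map_map (by fun_prop) (by fun_prop),
      Measure.map_map (by fun_prop) (by fun_prop)]
    congr 1
    ext1 p
    simp only [Function.comp_apply, Prod.map_fst, Prod.map_snd, id_eq, cdot_add,
      cdot_toEuclideanLin, hvl, smul_cdot, hη, ← hw]
    ring
  have : IsProbabilityMeasure (ν.1.map (cdot v)) :=
    Measure.isProbabilityMeasure_map (by fun_prop)
  have hsum := ae_summable_perpetuity hηm hηi hl
  have hlaw := map_perpetuity_eq hηm hηi hl hfix
  refine ⟨hπ, ν, d, h, v, w, l • v, l, -cdot v (∫ x, x ∂ν.1), hv, hl, hsum, ?_⟩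
  have hid : IdentDistrib (cdot v) (fun Y : ℕ → Vec m => ∑' k : ℕ, l ^ k * η (Y k)) ν.1
      (Measure.infinitePi fun _ : ℕ => margY π) := by
    refine ⟨by fun_prop, ?_, hlaw.symm⟩
    exact aemeasurable_of_map_neZero (by rw [hlaw]; infer_instance)
  have := hid.comp (u := fun z => z + -cdot v (∫ x, x ∂ν.1)) (by fun_prop)
  simpa only [Function.comp_def, ← sub_eq_add_neg, ← cdot_sub] using this

/-- If `vᵀZ` is almost surely constant, the zero series represents `vᵀ(Z - 𝔼 Z)`. -/
theorem mem_SnlDec_of_ae_eq {π : Joint n m} (hπ : π ∈ F n m) {ν : P2 (Vec n)} {d : Vec m → Vec n}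
    (h : IsTranslationWitness π ν d) {v : Fin n → ℂ} (hv : v ≠ 0)
    (hae : ∀ᵐ z ∂ν.1, cdot v (z - ∫ x, x ∂ν.1) = 0) : π ∈ SnlDec n m := by
  refine ⟨hπ, ν, d, h, v, 0, 0, 0, 0, hv, by simp, ?_, ?_⟩
  · simp [cdot]
  · have h0 : IdentDistrib (fun _ : Vec n => (0 : ℂ)) (fun _ : ℕ → Vec m => (0 : ℂ)) ν.1
        (Measure.infinitePi fun _ : ℕ => margY π) :=
      ⟨by fun_prop, by fun_prop, by simp⟩
    simpa [cdot] using (IdentDistrib.of_ae_eq (by fun_prop) hae).trans h0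

/-! ### Covariance matrices -/

section Covariance

variable {k : ℕ} {Ω : Type*} [MeasurableSpace Ω] {μ : Measure Ω}

/-- The covariance matrix of a random vector. -/
noncomputable def covMat (f : Ω → Vec k) (μ : Measure Ω) : Matrix (Fin k) (Fin k) ℝ :=
  Matrix.of fun i j => covariance (fun ω => f ω i) (fun ω => f ω j) μ

theorem memLp_coord {f : Ω → Vec k} (hf : MemLp f 2 μ) (i : Fin k) :
    MemLp (fun ω => f ω i) 2 μ :=
  (EuclideanSpace.proj (𝕜 := ℝ) i).comp_memLp' hf

theorem memLp_dotProduct {f : Ω → Vec k} (hf : MemLp f 2 μ) (v : Fin k → ℝ) :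
    MemLp (fun ω => v ⬝ᵥ (f ω).ofLp) 2 μ :=
  memLp_finsetSum _ fun i _ => (memLp_coord hf i).const_mul (v i)

theorem dotProduct_covMat_mulVec [IsFiniteMeasure μ] {f : Ω → Vec k} (hf : MemLp f 2 μ) (v : Fin k → ℝ) :
    v ⬝ᵥ covMat f μ *ᵥ v = variance (fun ω => v ⬝ᵥ (f ω).ofLp) μ := by
  simp only [dotProduct]
  rw [variance_fun_sum fun i => (memLp_coord hf i).const_mul (v i)]
  refine Finset.sum_congr rfl fun i _ => ?_
  rw [Matrix.mulVec, dotProduct, Finset.mul_sum]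
  refine Finset.sum_congr rfl fun j _ => ?_
  rw [covariance_const_mul_left, covariance_const_mul_right, covMat, Matrix.of_apply]
  ring

theorem isHermitian_covMat (f : Ω → Vec k) : (covMat f μ).IsHermitian := by
  ext i j
  simp [covMat, covariance_comm]

theorem ae_eq_const_of_variance_eq_zero [IsFiniteMeasure μ] {f : Ω → Vec k} (hf : MemLp f 2 μ)
    (h : ∀ v : Fin k → ℝ, variance (fun ω => v ⬝ᵥ (f ω).ofLp) μ = 0) :
    ∃ e : Vec k, ∀ᵐ ω ∂μ, f ω = e := by
  have hi : ∀ i, ∀ᵐ ω ∂μ, f ω i = ∫ x, f x i ∂μ := by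
    intro i
    refine ae_eq_integral_of_variance_eq_zero (memLp_coord hf i) ?_
    simpa using h (Pi.single i 1)
  refine ⟨WithLp.toLp 2 fun i => ∫ x, f x i ∂μ, ?_⟩
  filter_upwards [ae_all_iff.mpr hi] with ω hω
  ext i
  exact hω i

theorem covariance_congr_left {X X' Y : Ω → ℝ} (h : X =ᵐ[μ] X') :
    covariance X Y μ = covariance X' Y μ := by
  rw [covariance, covariance, integral_congr_ae h]
  refine integral_congr_ae ?_
  filter_upwards [h] with ω hω
  rw [hω]

theorem covariance_toEuclideanLin_add_const [IsProbabilityMeasure μ] {l : ℕ} {f : Ω → Vec l}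
    (hf : MemLp f 2 μ) (G : Matrix (Fin k) (Fin l) ℝ) (e : Vec k) (i : Fin k) (j : Fin l) :
    covariance (fun ω => (Matrix.toEuclideanLin G (f ω) + e) i) (fun ω => f ω j) μ
      = (G * covMat f μ) i j := by
  have h1 := memLp_coord (memLp_toEuclideanLin_comp G hf) i
  have h2 := covariance_add_const_left (Y := fun ω => f ω j) (h1.integrable (by norm_num)) (e i)
  refine h2.trans ?_
  simp only [ofLp_toEuclideanLin, Matrix.mulVec, dotProduct]
  rw [covariance_fun_sum_left (fun j' => (memLp_coord hf j').const_mul _) (memLp_coord hf j),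
    Matrix.mul_apply]
  simp only [covariance_const_mul_left, covMat, Matrix.of_apply]

end Covariance

/-! ### Degenerate noise and the Ensemble Kalman case -/

theorem mem_SnlDec_of_variance_eq_zero {π : Joint n m} (hπ : π ∈ F n m) {ν : P2 (Vec n)}
    {d : Vec m → Vec n} (h : IsTranslationWitness π ν d) {v : Fin n → ℝ} (hv : v ≠ 0)
    (hvar : variance (fun z : Vec n => v ⬝ᵥ z.ofLp) ν.1 = 0) : π ∈ SnlDec n m := by
  have hν : MemLp (fun z : Vec n => z) 2 ν.1 := ν.2.2
  have hcv : ∀ z : Vec n, cdot (fun i => (v i : ℂ)) z = ((v ⬝ᵥ z.ofLp : ℝ) : ℂ) := by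
    intro z
    simp [cdot, dotProduct]
  refine mem_SnlDec_of_ae_eq hπ h (v := fun i => (v i : ℂ)) ?_ ?_
  · intro h0
    apply hv
    ext i
    simpa using congrFun h0 i
  · have hmean : ∫ z : Vec n, v ⬝ᵥ z.ofLp ∂ν.1 = v ⬝ᵥ (∫ z : Vec n, z ∂ν.1).ofLp := by
      have hL := (∑ i, v i • EuclideanSpace.proj (𝕜 := ℝ) i : Vec n →L[ℝ] ℝ).integral_comp_comm
        (hν.integrable (by norm_num))
      simpa [dotProduct] using hL
    filter_upwards [ae_eq_integral_of_variance_eq_zero (memLp_dotProduct hν v) hvar] with z hz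
    rw [cdot_sub, hcv, hcv, hz, hmean, sub_self]

/-- Outside `S_nl-dec` no left eigenvalue of `A` has modulus below `1` and `Cov(Z)` is positive
definite, so the determinant argument makes `A d(Y) + B Y` almost surely constant, with `A`
invertible. -/
theorem ae_affine_or_mem_SnlDec {π : Joint n m} (hπ : π ∈ F n m)
    {A : Matrix (Fin n) (Fin n) ℝ} {B : Matrix (Fin n) (Fin m) ℝ} {d : Vec m → Vec n}
    (h : IsTranslationWitness π (linearPush π A B) d) (hS : π ∉ SnlDec n m) :
    ∃ (G : Matrix (Fin n) (Fin m) ℝ) (e : Vec n),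
      ∀ᵐ y ∂(margY π), d y = Matrix.toEuclideanLin G y + e := by
  have hd := h.1
  have hfix := h.map_affine_eq
  set ν := linearPush π A B with hνdef
  have hν : MemLp (fun z : Vec n => z) 2 ν.1 := ν.2.2
  have hA : ∀ (μ : ℂ) (v : Fin n → ℂ), v ≠ 0 → v ᵥ* A.map ((↑) : ℝ → ℂ) = μ • v → 1 ≤ ‖μ‖ := by
    intro μ v hv hμ
    by_contra! hlt
    exact hS (mem_SnlDec_of_eigenvector hπ h hv hμ hlt)
  have hpos : (covMat (fun z => z) ν.1).PosDef := by
    refine Matrix.PosDef.of_dotProduct_mulVec_pos (isHermitian_covMat _) fun v hv => ?_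
    rw [star_trivial, dotProduct_covMat_mulVec hν]
    refine lt_of_le_of_ne (variance_nonneg _ _) fun h0 => hS ?_
    exact mem_SnlDec_of_variance_eq_zero hπ h hv h0.symm
  set g : Vec m → Vec n := fun y => Matrix.toEuclideanLin A (d y) + Matrix.toEuclideanLin B y
    with hg
  have hgL : MemLp g 2 (margY π) := (memLp_toEuclideanLin_comp A h.memLp).add
    (memLp_toEuclideanLin_comp B (memLp_id_margY π))
  have hvar : ∀ v : Fin n → ℝ, v ⬝ᵥ (covMat (fun z => z) ν.1
      - A * covMat (fun z => z) ν.1 * Aᵀ) *ᵥ v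
      = variance (fun y => v ⬝ᵥ (g y).ofLp) (margY π) := by
    intro v
    have hq : v ⬝ᵥ (A * covMat (fun z => z) ν.1 * Aᵀ) *ᵥ v
        = variance (fun z : Vec n => (v ᵥ* A) ⬝ᵥ z.ofLp) ν.1 := by
      rw [← dotProduct_covMat_mulVec hν, ← Matrix.mulVec_mulVec, ← Matrix.mulVec_mulVec,
        Matrix.mulVec_transpose, Matrix.dotProduct_mulVec]
    have hsplit : variance (fun z : Vec n => v ⬝ᵥ z.ofLp) ν.1
        = variance (fun z : Vec n => (v ᵥ* A) ⬝ᵥ z.ofLp) ν.1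
          + variance (fun y => v ⬝ᵥ (g y).ofLp) (margY π) := by
      rw [← variance_add_prod (memLp_dotProduct hν _) (memLp_dotProduct hgL _)]
      conv_lhs => rw [← hfix]
      rw [variance_map (by fun_prop) (by fun_prop)]
      congr 1
      ext1 p
      simp [hg, Matrix.dotProduct_mulVec]
    rw [Matrix.sub_mulVec, dotProduct_sub, hq, dotProduct_covMat_mulVec hν, hsplit]
    ring
  have hps : (covMat (fun z => z) ν.1 - A * covMat (fun z => z) ν.1 * Aᵀ).PosSemidef := by
    refine Matrix.PosSemidef.of_dotProduct_mulVec_nonneg ?_ fun v => ?_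
    · refine (isHermitian_covMat _).sub ?_
      simpa using Matrix.isHermitian_mul_mul_conjTranspose A (isHermitian_covMat (μ := ν.1) _)
    · rw [star_trivial, hvar]
      exact variance_nonneg _ _
  have heq := eq_conj_of_one_le_norm_eigenvalues hA hpos hps
  obtain ⟨e, he⟩ := ae_eq_const_of_variance_eq_zero hgL fun v => by
    rw [← hvar, heq, sub_self, Matrix.zero_mulVec, dotProduct_zero]
  have hAu : IsUnit A.det := by
    have := one_le_abs_det A hA
    refine isUnit_iff_ne_zero.mpr fun h0 => ?_
    rw [h0, abs_zero] at this
    exact absurd this (by norm_num)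
  refine ⟨-(A⁻¹ * B), Matrix.toEuclideanLin A⁻¹ e, ?_⟩
  filter_upwards [he] with y hy
  rw [← hy]
  ext1
  simp [hg, Matrix.mulVec_mulVec, Matrix.nonsing_inv_mul _ hAu]

/-- If `d(y) = G y + e`, then `Σ_XY = G Σ_YY`, so the Kalman gain `K` satisfies `K Σ_YY = G Σ_YY`,
and the update `Z + d(Y) + K (y⋆ - Y)` equals `Z + d(y⋆)` almost surely. -/
theorem mem_EEnKU_of_ae_affine {π : Joint n m} {ν : P2 (Vec n)} {d : Vec m → Vec n}
    (h : IsTranslationWitness π ν d) {G : Matrix (Fin n) (Fin m) ℝ} {e : Vec n}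
    (hde : ∀ᵐ y ∂(margY π), d y = Matrix.toEuclideanLin G y + e) : π ∈ EEnKU n m := by
  have hd := h.1
  have hν : MemLp (fun z : Vec n => z) 2 ν.1 := ν.2.2
  have hY := memLp_id_margY π
  have hcovYY : covYY π = covMat (fun y => y) (margY π) := by
    ext i j
    rw [covYY, covMat, margY, Measure.snd, Matrix.of_apply, Matrix.of_apply,
      covariance_map (by fun_prop) (by fun_prop) (by fun_prop)]
    rfl
  have hcovXY : covXY π = G * covYY π := by
    ext i j
    have hj : MemLp (fun p : Vec n × Vec m => p.2 j) 2 (ν.1.prod (margY π)) :=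
      (memLp_coord hY j).comp_snd ν.1
    rw [covXY, Matrix.of_apply]
    conv_lhs => rw [← h.map_prod_eq]
    rw [covariance_map_fun (by fun_prop) (by fun_prop) (by fun_prop)]
    have hsnd : covariance (fun p : Vec n × Vec m => d p.2 i) (fun p => p.2 j)
        (ν.1.prod (margY π)) = covariance (fun y => d y i) (fun y => y j) (margY π) := by
      have hmap : (ν.1.prod (margY π)).map (fun p => p.2) = margY π :=
        measurePreserving_snd.map_eq
      conv_rhs => rw [← hmap]
      rw [covariance_map_fun (by fun_prop) (by fun_prop) (by fun_prop)]
    have hadd := covariance_add_left (Z := fun p : Vec n × Vec m => p.2 j)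
      ((memLp_coord hν i).comp_fst (margY π)) ((memLp_coord h.memLp i).comp_snd ν.1) hj
    refine hadd.trans ?_
    rw [covariance_fst_snd_prod (memLp_coord hν i) (memLp_coord hY j), zero_add, hsnd, hcovYY,
      ← covariance_toEuclideanLin_add_const hY G e]
    refine covariance_congr_left ?_
    filter_upwards [hde] with y hy
    rw [hy]
  have hK : kalmanGain π * covYY π = G * covYY π := by
    rw [kalmanGain, hcovXY, Matrix.mul_assoc, Matrix.mul_assoc, ← Matrix.mul_assoc (covYY π),
      (isPenrose_pinv (covYY π)).mul_mul_self]
  -- `Cov((K - G) Y) = (K - G) Σ_YY (K - G)ᵀ = 0`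
  obtain ⟨a, ha⟩ : ∃ a : Vec n, ∀ᵐ y ∂(margY π),
      Matrix.toEuclideanLin (kalmanGain π - G) y = a := by
    refine ae_eq_const_of_variance_eq_zero (memLp_toEuclideanLin_comp _ hY) fun v => ?_
    have : (fun y : Vec m => v ⬝ᵥ (Matrix.toEuclideanLin (kalmanGain π - G) y).ofLp)
        = fun y => (v ᵥ* (kalmanGain π - G)) ⬝ᵥ y.ofLp := by
      ext1 y
      rw [ofLp_toEuclideanLin, Matrix.dotProduct_mulVec]
    rw [this, ← dotProduct_covMat_mulVec hY, ← hcovYY, Matrix.dotProduct_mulVec,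
      Matrix.vecMul_vecMul, Matrix.sub_mul, hK, sub_self, Matrix.vecMul_zero, zero_dotProduct]
  have hprod := h.map_prod_eq
  have hdep : ∀ᵐ p ∂(ν.1.prod (margY π)), d p.2 = Matrix.toEuclideanLin G p.2 + e ∧
      Matrix.toEuclideanLin (kalmanGain π - G) p.2 = a :=
    measurePreserving_snd.quasiMeasurePreserving.ae (hde.and ha)
  obtain ⟨-, κ, hκ, hκd⟩ := h
  refine ⟨κ, hκ, ?_⟩
  filter_upwards [hde, ha] with ys hys has
  have hmeas : Measurable ((enKU n m).toMap π ys) := by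
    unfold AffineCondMap.toMap
    fun_prop
  have hfst : (ν.1.prod (margY π)).map (fun p => p.1) = ν.1 := measurePreserving_fst.map_eq
  conv_lhs => rw [← hprod]
  conv_rhs => rw [hκd, ← hfst]
  rw [Measure.map_map hmeas (by fun_prop), Measure.map_map (by fun_prop) (by fun_prop)]
  refine Measure.map_congr ?_
  filter_upwards [hdep] with p hp
  rw [Function.comp_apply, Function.comp_apply, enKU_toMap, hp.1, hys]
  have h1 := has.trans hp.2.symm
  rw [map_sub, LinearMap.sub_apply, LinearMap.sub_apply] at h1
  rw [map_sub, sub_eq_iff_eq_add.mp h1]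
  abel

theorem EEnKU_subset_F : EEnKU n m ⊆ F n m := fun _ hπ =>
  Set.mem_iUnion₂.mpr ⟨enKU n m, ⟨fun _ => 1, fun π => -kalmanGain π, fun _ _ => ⟨rfl, rfl⟩⟩, hπ⟩

end AffineCond

theorem theorem3p2 (n m : ℕ) :
    AffineCond.F n m = AffineCond.EEnKU n m ∪ AffineCond.SnlDec n m := by
  refine Set.Subset.antisymm (fun π hπ => ?_)
    (Set.union_subset AffineCond.EEnKU_subset_F fun _ hπ => hπ.1)
  obtain ⟨A, B, d, h⟩ := AffineCond.exists_isTranslationWitness hπ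
  by_cases hS : π ∈ AffineCond.SnlDec n m
  · exact Or.inr hS
  · obtain ⟨G, e, hde⟩ := AffineCond.ae_affine_or_mem_SnlDec hπ h hS
    exact Or.inl (AffineCond.mem_EEnKU_of_ae_affine h hde)
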